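/- Let $n\ge 0$ and write $n+1=2^a b$ with $b$ odd. Let $A_n$ be the transition matrix of the $\Phi$ automaton on a row of $n$ lights, that is, the $n\times n$ matrix over $GF(2)$ whose $(i,j)$ entry is $1$ if $|i-j|=1$ and $0$ otherwise. Let $CL(\Phi_n)$ be its cycle length, the least integer $i>0$ such that $A_n^{k}=A_n^{k+i}$ for some $k\ge 0$. Let $\mathrm{sord}_2(b)$ be the least integer $j>0$ such that $2^j\equiv 1$ or $2^j\equiv -1 \pmod b$. (1) If $b>1$ (that is, $n+1$ is not a power of $2$), then $$CL(\Phi_n)=2^{a+1}\,\frac{2^{\mathrm{sord}_2(b)}-1}{q}$$ for some divisor $q$ of $2^{\mathrm{sord}_2(b)}-1$. (2) If $b=1$ (that is, $n+1=2^a$), then $CL(\Phi_n)=1$. (3) Let $K$ be any field extension of $GF(2)$ that contains an element $\alpha$ of multiplicative order $b$. Then the nonzero eigenvalues of $A_n$ in $K$ are exactly the elements $\alpha^k+\alpha^{-k}$ with $1\le k\le (b-1)/2$, and the smallest subfield of $K$ containing all eigenvalues of $A_n$ in $K$ has exactly $2^{\mathrm{sord}_2(b)}$ elements; in particular the eigenvalues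 lie in $GF(2^{\mathrm{sord}_2(b)})$. -/

import Mathlib

namespace LightsOut

/-- The transition matrix `A_n` over `GF(2)` of the `Φ` automaton on a row of `n` lights: the new
state of a light is the sum modulo 2 of the states of its (one or two) neighbours. -/
def phiMatrix (n : ℕ) : Matrix (Fin n) (Fin n) (ZMod 2) :=
  Matrix.of fun i j => if (i : ℕ) + 1 = (j : ℕ) ∨ (j : ℕ) + 1 = (i : ℕ) then 1 else 0

/-- The cycle length `CL(X)`: the least `i > 0` such that `X ^ k = X ^ (k + i)` for some `k`. -/
noncomputable def cycleLength {M : Type*} [Monoid M] (X : M) : ℕ :=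
  sInf {i : ℕ | 0 < i ∧ ∃ k : ℕ, X ^ k = X ^ (k + i)}

/-- The suborder of 2 modulo `b`: the least `j > 0` with `2 ^ j ≡ ±1 (mod b)`. -/
noncomputable def sord (b : ℕ) : ℕ :=
  sInf {j : ℕ | 0 < j ∧ ((2 : ℤ) ^ j ≡ 1 [ZMOD b] ∨ (2 : ℤ) ^ j ≡ -1 [ZMOD b])}

/-- In a finite monoid the set in the definition of the cycle length is not empty, so the infimum
is attained. -/
theorem cycleLength_mem {M : Type*} [Monoid M] [Finite M] (X : M) :
    0 < cycleLength X ∧ ∃ k : ℕ, X ^ k = X ^ (k + cycleLength X) := by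
  have hne : {i : ℕ | 0 < i ∧ ∃ k : ℕ, X ^ k = X ^ (k + i)}.Nonempty := by
    obtain ⟨p, q, hpq, h⟩ := Finite.exists_ne_map_eq_of_infinite (fun k : ℕ => X ^ k)
    rcases lt_or_gt_of_ne hpq with hlt | hlt
    · exact ⟨q - p, by omega, p, by simpa [Nat.add_sub_cancel' hlt.le] using h⟩
    · exact ⟨p - q, by omega, q, by simpa [Nat.add_sub_cancel' hlt.le] using h.symm⟩
  exact Nat.sInf_mem hne

/-- For odd `b` the set in the definition of `sord b` is not empty, so the infimum is attained. -/
theorem sord_mem {b : ℕ} (hb : Odd b) :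
    0 < sord b ∧ ((2 : ℤ) ^ sord b ≡ 1 [ZMOD b] ∨ (2 : ℤ) ^ sord b ≡ -1 [ZMOD b]) := by
  have hne : {j : ℕ | 0 < j ∧ ((2 : ℤ) ^ j ≡ 1 [ZMOD b] ∨ (2 : ℤ) ^ j ≡ -1 [ZMOD b])}.Nonempty := by
    refine ⟨b.totient, Nat.totient_pos.2 hb.pos, Or.inl ?_⟩
    have h := Nat.ModEq.pow_totient (Nat.coprime_two_left.2 hb)
    exact_mod_cast (Int.natCast_modEq_iff.2 h)
  exact Nat.sInf_mem hne

end LightsOut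

namespace LightsOut

open Polynomial

/-! The first basis vector is cyclic, and the minimal polynomial of `A_n` is the Chebyshev
polynomial `S_n` (`minpoly_phiMatrixMap`). In characteristic 2, `X * S_n = C_{n+1}`, and doubling an
index of `C` squares it; hence `S_n = X^(2^a-1) * P^(2^(a+1))`, where `P` has the simple nonzero
roots `α^k + α^(-k)` (`S_eq_X_pow_mul_eigenPoly_pow`). Then `A_n^k = A_n^(k+i)` means `S_n ∣ X^k
(X^i - 1)`. Multiplicities force `2^(a+1) ∣ i`; the roots force the odd common order of the
eigenvalues to divide `i` (`exists_dvd_X_pow_mul_iff`). For the field, Frobenius `x ↦ x^(2^j)` fixes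
`α + α⁻¹` exactly when `α^(2^j) = α^(±1)`, i.e. `2^j ≡ ±1` mod `b`. -/

theorem monic_S_and_natDegree_S (R : Type*) [CommRing R] [Nontrivial R] (n : ℕ) :
    (Chebyshev.S R n).Monic ∧ (Chebyshev.S R n).natDegree = n := by
  induction n using Nat.twoStepInduction with
  | zero => simp
  | one => simp
  | more n ih0 ih1 =>
    obtain ⟨h0, d0⟩ := ih0
    obtain ⟨h1, d1⟩ := ih1
    push_cast at h1 d1 ⊢
    rw [Chebyshev.S_add_two]
    have hm : (X * Chebyshev.S R ((n : ℤ) + 1)).Monic := monic_X.mul h1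
    have hd : (X * Chebyshev.S R ((n : ℤ) + 1)).natDegree = n + 2 := by
      rw [monic_X.natDegree_mul h1, d1, natDegree_X]; ring
    have hlt : (Chebyshev.S R n).natDegree < (X * Chebyshev.S R ((n : ℤ) + 1)).natDegree := by
      omega
    exact ⟨hm.sub_of_left (degree_lt_degree hlt), by
      rw [natDegree_sub_eq_left_of_natDegree_lt hlt, hd]⟩

theorem S_two_mul_and_S_two_mul_add_one (R : Type*) [CommRing R] (n : ℕ) :
    Chebyshev.S R (2 * n) = Chebyshev.S R n ^ 2 - Chebyshev.S R (n - 1) ^ 2 ∧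
    Chebyshev.S R (2 * n + 1) =
      Chebyshev.S R n * (Chebyshev.S R (n + 1) - Chebyshev.S R (n - 1)) := by
  induction n with
  | zero => simp
  | succ n ih =>
    obtain ⟨h0, h1⟩ := ih
    have e0 := Chebyshev.S_add_two R (2 * n)
    have e1 := Chebyshev.S_add_two R (2 * n + 1)
    have e2 := Chebyshev.S_add_one R n
    have e3 := Chebyshev.S_add_two R n
    push_cast
    rw [show (2 : ℤ) * (n + 1) = 2 * n + 2 by ring,
      show (2 : ℤ) * n + 2 + 1 = 2 * n + 1 + 2 by ring, e1,
      show (2 : ℤ) * n + 1 + 1 = 2 * n + 2 by ring, e0, h0, h1,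
      show (n : ℤ) + 1 - 1 = n by ring, show (n : ℤ) + 1 + 1 = n + 2 by ring, e3, e2]
    constructor <;> ring

theorem eval_C_add_inv {K : Type*} [Field K] {x : K} (hx : x ≠ 0) (n : ℕ) :
    (Chebyshev.C K n).eval (x + x⁻¹) = x ^ n + (x ^ n)⁻¹ := by
  rw [← dickson_one_one_eq_chebyshev_C, dickson_one_one_eval_add_inv x x⁻¹ (mul_inv_cancel₀ hx),
    inv_pow]

theorem add_inv_eq_add_inv_iff {K : Type*} [Field K] {x y : K} (hx : x ≠ 0) (hy : y ≠ 0) :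
    x + x⁻¹ = y + y⁻¹ ↔ x = y ∨ x * y = 1 := by
  have h : x + x⁻¹ - (y + y⁻¹) = (x - y) * (x * y - 1) * (x * y)⁻¹ := by
    field_simp
    ring
  rw [← sub_eq_zero, h]
  simp [hx, hy, sub_eq_zero]

theorem injOn_pow_add_inv {K : Type*} [Field K] {α : K} {m : ℕ} (hα : IsPrimitiveRoot α (2 * m + 1)) :
    Set.InjOn (fun k : ℕ => α ^ k + (α ^ k)⁻¹) (Finset.Icc 1 m : Finset ℕ) := by
  intro k hk l hl h
  simp only [Finset.coe_Icc, Set.mem_Icc] at hk hl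
  have h0 : α ≠ 0 := hα.ne_zero (by omega)
  rcases (add_inv_eq_add_inv_iff (pow_ne_zero _ h0) (pow_ne_zero _ h0)).1 h with h | h
  · exact hα.pow_inj (by omega) (by omega) h
  · rw [← pow_add] at h
    exact absurd h (hα.pow_ne_one_of_pos_of_lt (by omega) (by omega))

/-- The polynomial whose roots are the nonzero eigenvalues. -/
noncomputable def eigenPoly {K : Type*} [Field K] (α : K) (m : ℕ) : K[X] :=
  ∏ k ∈ Finset.Icc 1 m, (X - C (α ^ k + (α ^ k)⁻¹))

theorem X_sub_C_dvd_eigenPoly {K : Type*} [Field K] (α : K) {m k : ℕ}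
    (hk : k ∈ Finset.Icc 1 m) : X - C (α ^ k + (α ^ k)⁻¹) ∣ eigenPoly α m :=
  Finset.dvd_prod_of_mem (fun k : ℕ => X - C (α ^ k + (α ^ k)⁻¹)) hk

theorem eigenPoly_dvd {K : Type*} [Field K] {α : K} {m : ℕ} (hα : IsPrimitiveRoot α (2 * m + 1)) {p : K[X]}
    (hp : ∀ k ∈ Finset.Icc 1 m, p.IsRoot (α ^ k + (α ^ k)⁻¹)) : eigenPoly α m ∣ p :=
  Finset.prod_dvd_of_coprime
    (fun _ hk _ hl hkl => isCoprime_X_sub_C_of_isUnit_sub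
      (sub_ne_zero.2 fun h => hkl (injOn_pow_add_inv hα hk hl h)).isUnit)
    fun k hk => dvd_iff_isRoot.2 (hp k hk)

/-! ### Factorization of `S_n` in characteristic 2 -/

section CharTwo

variable (K : Type*) [Field K] [CharP K 2]

theorem X_mul_S_sub_one (n : ℤ) : X * Chebyshev.S K (n - 1) = Chebyshev.C K n := by
  rw [Chebyshev.C_eq_S_sub_X_mul_S, CharTwo.two_eq_zero, zero_mul, zero_sub, CharTwo.neg_eq]

theorem C_two_pow_mul (a : ℕ) (b : ℤ) :
    Chebyshev.C K (2 ^ a * b) = Chebyshev.C K b ^ 2 ^ a := by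
  induction a with
  | zero => simp
  | succ a ih =>
    rw [pow_succ', mul_assoc, Chebyshev.C_mul, Chebyshev.C_two, ih, pow_succ 2 a, pow_mul,
      CharTwo.two_eq_zero (R := K[X])]
    simp

theorem S_two_mul_eq_sq (n : ℕ) :
    Chebyshev.S K (2 * n) = (Chebyshev.S K n + Chebyshev.S K (n - 1)) ^ 2 := by
  rw [(S_two_mul_and_S_two_mul_add_one K n).1, CharTwo.add_sq, CharTwo.sub_eq_add]

variable {K}

theorem add_inv_eq_zero_iff {x : K} (hx : x ≠ 0) : x + x⁻¹ = 0 ↔ x = 1 := by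
  have h := add_inv_eq_add_inv_iff hx (one_ne_zero (α := K))
  rwa [inv_one, CharTwo.add_self_eq_zero, mul_one, or_self] at h

theorem pow_add_inv_ne_zero {α : K} {m : ℕ} (hα : IsPrimitiveRoot α (2 * m + 1)) {k : ℕ}
    (hk : k ∈ Finset.Icc 1 m) : α ^ k + (α ^ k)⁻¹ ≠ 0 := by
  rw [Finset.mem_Icc] at hk
  rw [Ne, add_inv_eq_zero_iff (pow_ne_zero _ (hα.ne_zero (by omega)))]
  exact hα.pow_ne_one_of_pos_of_lt (by omega) (by omega)

/-- Since `C_b(x + x⁻¹) = x^b + x^(-b)` vanishes at `x = α^k` and `C_b = X (S_m + S_{m-1})^2` for `b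
= 2m+1`, the monic left side of degree `m` has these `m` distinct roots. -/
theorem S_add_S_sub_one_eq_eigenPoly {α : K} {m : ℕ} (hα : IsPrimitiveRoot α (2 * m + 1)) :
    Chebyshev.S K m + Chebyshev.S K (m - 1) = eigenPoly α m := by
  have h0 : α ≠ 0 := hα.ne_zero (by omega)
  have hdeg : (Chebyshev.S K (m - 1)).degree < (Chebyshev.S K m).degree := by
    cases m with
    | zero => simp
    | succ m =>
      rw [Nat.cast_succ, add_sub_cancel_right]
      apply degree_lt_degree
      have h := (monic_S_and_natDegree_S K (m + 1)).2
      push_cast at h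
      rw [h, (monic_S_and_natDegree_S K m).2]
      exact Nat.lt_succ_self m
  refine (eq_of_monic_of_dvd_of_natDegree_le (monic_prod_of_monic _ _ fun k _ => monic_X_sub_C _)
    ((monic_S_and_natDegree_S K m).1.add_of_left hdeg) (eigenPoly_dvd hα fun k hk => ?_) ?_)
  · have h := congrArg (eval (α ^ k + (α ^ k)⁻¹)) (X_mul_S_sub_one K ((2 * m + 1 : ℕ) : ℤ))
    rw [eval_C_add_inv (pow_ne_zero _ h0), ← pow_mul, mul_comm k, pow_mul, hα.pow_eq_one, one_pow,
      inv_one, CharTwo.add_self_eq_zero] at h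
    push_cast at h
    rw [add_sub_cancel_right, S_two_mul_eq_sq] at h
    simpa [pow_add_inv_ne_zero hα hk] using h
  · rw [natDegree_add_eq_left_of_degree_lt hdeg, (monic_S_and_natDegree_S K m).2, eigenPoly,
      natDegree_finsetProd_X_sub_C_eq_card]
    simp

theorem S_eq_X_pow_mul_eigenPoly_pow {α : K} {m : ℕ} (hα : IsPrimitiveRoot α (2 * m + 1))
    {n a : ℕ} (hn : n + 1 = 2 ^ a * (2 * m + 1)) :
    Chebyshev.S K n = X ^ (2 ^ a - 1) * eigenPoly α m ^ 2 ^ (a + 1) := by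
  apply mul_left_cancel₀ (X_ne_zero (R := K))
  have h1 := X_mul_S_sub_one K ((n : ℤ) + 1)
  have h2 := X_mul_S_sub_one K (2 * m + 1)
  rw [add_sub_cancel_right] at h1 h2
  rw [h1, show (n : ℤ) + 1 = 2 ^ a * (2 * m + 1) by exact_mod_cast hn, C_two_pow_mul, ← h2,
    S_two_mul_eq_sq, S_add_S_sub_one_eq_eigenPoly hα, mul_pow, ← mul_assoc, ← pow_succ',
    Nat.sub_add_cancel Nat.one_le_two_pow, ← pow_mul, ← pow_succ']

theorem isRoot_S_iff {α : K} {m : ℕ} (hα : IsPrimitiveRoot α (2 * m + 1))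
    {n a : ℕ} (hn : n + 1 = 2 ^ a * (2 * m + 1)) {x : K} (hx : x ≠ 0) :
    (Chebyshev.S K n).IsRoot x ↔ ∃ k ∈ Finset.Icc 1 m, x = α ^ k + (α ^ k)⁻¹ := by
  rw [S_eq_X_pow_mul_eigenPoly_pow hα hn, IsRoot.def, eigenPoly]
  simp [eval_prod, Finset.prod_eq_zero_iff, sub_eq_zero, hx]

end CharTwo

/-! ### Minimal polynomial of the transition matrix -/

section Matrix

variable (K : Type*) [Field K] [Algebra (ZMod 2) K]

/-- The transition matrix over an extension field of `GF(2)`. -/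
noncomputable def phiMatrixMap (n : ℕ) : Matrix (Fin n) (Fin n) K :=
  (phiMatrix n).map (algebraMap (ZMod 2) K)

theorem phiMatrixMap_apply (n : ℕ) (i j : Fin n) : phiMatrixMap K n i j =
    if (i : ℕ) + 1 = (j : ℕ) ∨ (j : ℕ) + 1 = (i : ℕ) then 1 else 0 := by
  simp only [phiMatrixMap, phiMatrix, Matrix.map_apply, Matrix.of_apply]
  split_ifs <;> simp

/-- The `i`-th standard basis vector, and zero for `i ≥ n`. -/
def stdVec (n i : ℕ) : Fin n → K := fun j => if (j : ℕ) = i then 1 else 0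

theorem phiMatrixMap_mulVec_stdVec {n i : ℕ} (hi : i < n) (j : Fin n) :
    (phiMatrixMap K n).mulVec (stdVec K n i) j =
      if (j : ℕ) + 1 = i ∨ i + 1 = (j : ℕ) then 1 else 0 := by
  rw [show stdVec K n i = Pi.single (⟨i, hi⟩ : Fin n) (1 : K) by
    ext j; simp [stdVec, Pi.single_apply, Fin.ext_iff]]
  rw [Matrix.mulVec_single_one, Matrix.col_apply, phiMatrixMap_apply]

/-- The recurrence of `S` matches `A e_{i+1} = e_i + e_{i+2}`. The case `i = n`, where `e_n = 0`,
yields the annihilation by `S_n`. -/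
theorem aeval_S_mulVec_stdVec_zero (n : ℕ) (i : ℕ) (hi : i ≤ n) :
    (aeval (phiMatrixMap K n) (Chebyshev.S K i)).mulVec (stdVec K n 0) = stdVec K n i := by
  induction i using Nat.twoStepInduction with
  | zero => simp
  | one =>
    ext j
    simp only [Nat.cast_one, Chebyshev.S_one, aeval_X]
    rw [phiMatrixMap_mulVec_stdVec K hi]
    simp [stdVec, eq_comm]
  | more i ih0 ih1 =>
    have h0 := ih0 (by omega)
    have h1 := ih1 (by omega)
    push_cast at h1 ⊢
    rw [Chebyshev.S_add_two, map_sub, map_mul, aeval_X, Matrix.sub_mulVec, ← Matrix.mulVec_mulVec,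
      h1, h0]
    ext j
    rw [Pi.sub_apply, phiMatrixMap_mulVec_stdVec K (by omega)]
    simp only [stdVec]
    split_ifs <;> first | omega | simp

theorem aeval_S_phiMatrixMap (n : ℕ) : aeval (phiMatrixMap K n) (Chebyshev.S K n) = 0 := by
  ext i j
  have h0 : (aeval (phiMatrixMap K n) (Chebyshev.S K n)).mulVec (stdVec K n 0) = 0 := by
    rw [aeval_S_mulVec_stdVec_zero K n n le_rfl]
    ext j
    simp [stdVec, j.2.ne]
  have h : (aeval (phiMatrixMap K n) (Chebyshev.S K n)).mulVec (stdVec K n j) = 0 := by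
    rw [← aeval_S_mulVec_stdVec_zero K n j j.2.le, Matrix.mulVec_mulVec, ← map_mul, mul_comm,
      map_mul, ← Matrix.mulVec_mulVec, h0, Matrix.mulVec_zero]
  rw [show stdVec K n j = Pi.single j (1 : K) by
    ext i; simp [stdVec, Pi.single_apply, Fin.ext_iff], Matrix.mulVec_single_one] at h
  exact congrFun h i

/-- A signal moves one light per step, so entry `d` of `p(A) e_0` is the leading coefficient of `p`
when `d = deg p < n`; hence no such nonzero `p` kills `A`. -/
theorem pow_mulVec_stdVec_zero {n : ℕ} (k : ℕ) (j : Fin n) (hj : k ≤ j) :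
    ((phiMatrixMap K n) ^ k).mulVec (stdVec K n 0) j = if (j : ℕ) = k then 1 else 0 := by
  induction k generalizing j with
  | zero => simp [stdVec]
  | succ k ih =>
    rw [pow_succ', ← Matrix.mulVec_mulVec, Matrix.mulVec_eq_sum, Finset.sum_apply,
      Finset.sum_eq_single (⟨k, by omega⟩ : Fin n)]
    · rw [Pi.smul_apply, ih _ le_rfl, Matrix.transpose_apply, phiMatrixMap_apply]
      simp only [if_true, MulOpposite.op_one, one_smul]
      exact if_congr (by omega) rfl rfl
    · intro i _ hi
      have hi' : (i : ℕ) ≠ k := fun h => hi (Fin.ext h)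
      rcases lt_or_ge (i : ℕ) k with h | h
      · rw [Pi.smul_apply, Matrix.transpose_apply, phiMatrixMap_apply, if_neg (by omega), smul_zero]
      · simp [ih i h, hi']
    · simp

theorem minpoly_phiMatrixMap (n : ℕ) : minpoly K (phiMatrixMap K n) = Chebyshev.S K n := by
  have hint : IsIntegral K (phiMatrixMap K n) := Matrix.isIntegral _
  refine (eq_of_monic_of_dvd_of_natDegree_le (minpoly.monic hint) (monic_S_and_natDegree_S K n).1
    (minpoly.dvd K _ (aeval_S_phiMatrixMap K n)) ?_).symm
  rw [(monic_S_and_natDegree_S K n).2]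
  by_contra! hlt
  have h := congrArg (fun M => M.mulVec (stdVec K n 0) ⟨(minpoly K (phiMatrixMap K n)).natDegree, hlt⟩)
    (minpoly.aeval K (phiMatrixMap K n))
  rw [aeval_eq_sum_range] at h
  simp only [Matrix.sum_mulVec, Finset.sum_apply, Matrix.smul_mulVec, Pi.smul_apply,
    Matrix.zero_mulVec, Pi.zero_apply] at h
  rw [Finset.sum_range_succ, Finset.sum_eq_zero,
    pow_mulVec_stdVec_zero K (minpoly K (phiMatrixMap K n)).natDegree ⟨_, hlt⟩ le_rfl] at h
  · simp [minpoly.ne_zero hint] at h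
  · intro k hk
    rw [Finset.mem_range] at hk
    rw [pow_mulVec_stdVec_zero K _ _ hk.le]
    simp [hk.ne']

theorem hasEigenvalue_phiMatrixMap_iff (n : ℕ) (x : K) :
    Module.End.HasEigenvalue (Matrix.toLin' (phiMatrixMap K n)) x ↔
      (Chebyshev.S K n).IsRoot x := by
  rw [Module.End.hasEigenvalue_iff_isRoot, Matrix.minpoly_toLin', minpoly_phiMatrixMap]

theorem phiMatrix_pow_eq_iff (n k i : ℕ) :
    phiMatrix n ^ k = phiMatrix n ^ (k + i) ↔ Chebyshev.S K n ∣ X ^ k * (X ^ i - 1) := by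
  have hinj : Function.Injective ((algebraMap (ZMod 2) K).mapMatrix (m := Fin n)) :=
    Matrix.map_injective (algebraMap (ZMod 2) K).injective
  rw [← hinj.eq_iff, map_pow, map_pow, RingHom.mapMatrix_apply, ← phiMatrixMap, ← minpoly_phiMatrixMap,
    minpoly.dvd_iff, eq_comm, ← sub_eq_zero]
  simp [mul_sub, pow_add]

end Matrix

/-! ### Field of eigenvalues and cycle length -/

section CharTwo

variable {K : Type*} [Field K] [CharP K 2]

theorem add_inv_pow_two_pow_eq_iff {x : K} (hx : x ≠ 0) (j : ℕ) :
    (x + x⁻¹) ^ 2 ^ j = x + x⁻¹ ↔ x ^ 2 ^ j = x ∨ x ^ 2 ^ j * x = 1 := by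
  rw [add_pow_char_pow, inv_pow, add_inv_eq_add_inv_iff (pow_ne_zero _ hx) hx]

theorem add_inv_pow_two_pow_eq_iff_modEq {α : K} {b : ℕ} (hb : b ≠ 0) (hα : IsPrimitiveRoot α b)
    (j : ℕ) :
    (α + α⁻¹) ^ 2 ^ j = α + α⁻¹ ↔ (2 : ℤ) ^ j ≡ 1 [ZMOD b] ∨ (2 : ℤ) ^ j ≡ -1 [ZMOD b] := by
  have h0 : α ≠ 0 := hα.ne_zero hb
  rw [add_inv_pow_two_pow_eq_iff h0]
  refine or_congr ?_ ?_
  · rw [Int.modEq_comm, Int.modEq_iff_dvd, ← hα.zpow_eq_one_iff_dvd, zpow_sub_one₀ h0,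
      mul_inv_eq_one₀ h0]
    norm_cast
  · rw [Int.modEq_comm, Int.modEq_iff_dvd, ← hα.zpow_eq_one_iff_dvd, sub_neg_eq_add,
      zpow_add_one₀ h0]
    norm_cast

theorem pow_add_inv_pow_two_pow_sord {α : K} {b : ℕ} (hb : Odd b) (hα : IsPrimitiveRoot α b)
    (k : ℕ) : (α ^ k + (α ^ k)⁻¹) ^ 2 ^ sord b = α ^ k + (α ^ k)⁻¹ := by
  have h0 : α ≠ 0 := hα.ne_zero hb.pos.ne'
  rw [add_inv_pow_two_pow_eq_iff (pow_ne_zero _ h0), ← pow_mul, mul_comm, pow_mul]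
  rcases (add_inv_pow_two_pow_eq_iff h0 _).1
    ((add_inv_pow_two_pow_eq_iff_modEq hb.pos.ne' hα _).2 (sord_mem hb).2) with h | h
  · exact Or.inl (by rw [h])
  · exact Or.inr (by rw [← mul_pow, h, one_pow])

theorem card_subfield_closure_eq_two_pow_sord {α : K} {b : ℕ} (hb : Odd b)
    (hα : IsPrimitiveRoot α b) {s : Set K} (hs : ∀ x ∈ s, x ^ 2 ^ sord b = x)
    (hmem : α + α⁻¹ ∈ Subfield.closure s) :
    Nat.card (Subfield.closure s) = 2 ^ sord b := by
  classical
  have hpos := (sord_mem hb).1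
  -- The fixed points of a Frobenius power form a subfield.
  have hfix : ∀ x ∈ Subfield.closure s, x ^ 2 ^ sord b = x := fun x hx =>
    (Subfield.closure_le (t := (iterateFrobenius K 2 (sord b)).eqLocusField (RingHom.id K))).2
      (fun y hy => hs y hy) hx
  have hq : 1 < 2 ^ sord b := Nat.one_lt_two_pow hpos.ne'
  have hne : (X ^ 2 ^ sord b - X : K[X]) ≠ 0 := FiniteField.X_pow_card_sub_X_ne_zero K hq
  have hsub : (Subfield.closure s : Set K) ⊆ ((X ^ 2 ^ sord b - X : K[X]).roots.toFinset : Set K) := by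
    intro x hx
    simp [hne, hfix x hx]
  have hfin : Finite (Subfield.closure s) := (Finset.finite_toSet _).subset hsub
  have hle : Nat.card (Subfield.closure s) ≤ 2 ^ sord b := by
    calc Nat.card (Subfield.closure s) = (Subfield.closure s : Set K).ncard := rfl
      _ ≤ _ := Set.ncard_le_ncard hsub (Finset.finite_toSet _)
      _ ≤ _ := by
        rw [Set.ncard_coe_finset]
        refine (Multiset.toFinset_card_le _).trans ((card_roots' _).trans ?_)
        rw [FiniteField.X_pow_card_sub_X_natDegree_eq K hq]
  have := Fintype.ofFinite (Subfield.closure s)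
  have : CharP (Subfield.closure s) 2 := inferInstance
  obtain ⟨d, -, hd⟩ := FiniteField.card (Subfield.closure s) 2
  have hpow : (α + α⁻¹) ^ 2 ^ (d : ℕ) = α + α⁻¹ := by
    have h := FiniteField.pow_card (⟨_, hmem⟩ : Subfield.closure s)
    rw [hd] at h
    exact congrArg Subtype.val h
  have hsd : sord b ≤ d :=
    Nat.sInf_le ⟨d.pos, (add_inv_pow_two_pow_eq_iff_modEq hb.pos.ne' hα _).1 hpow⟩
  refine le_antisymm hle ?_
  rw [Nat.card_eq_fintype_card, hd]
  exact Nat.pow_le_pow_right two_pos hsd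

/-- `X^(2^s t) - 1 = (X^t - 1)^(2^s)` with `X^t - 1` separable, so its roots have multiplicity
exactly `2^s`. -/
theorem le_two_pow_of_pow_dvd {x : K} (hx : x ≠ 0) {N k s t : ℕ} (ht : Odd t)
    (h : (X - C x) ^ N ∣ X ^ k * (X ^ (2 ^ s * t) - 1)) : N ≤ 2 ^ s := by
  classical
  have hsep : (X ^ t - 1 : K[X]).Separable := by
    rw [X_pow_sub_one_separable_iff, Ne, CharP.cast_eq_zero_iff K 2]
    exact ht.not_two_dvd_nat
  have hcop : IsCoprime ((X - C x) ^ N) (X ^ k : K[X]) := by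
    have := isCoprime_X_sub_C_of_isUnit_sub (a := x) (b := 0) (by simpa using hx)
    rw [C_0, sub_zero] at this
    exact this.pow
  have h' := hcop.dvd_of_dvd_mul_left h
  rw [mul_comm, pow_mul, ← one_pow (2 ^ s), ← sub_pow_char_pow,
    ← le_rootMultiplicity_iff (pow_ne_zero _ hsep.ne_zero), ← count_roots, roots_pow,
    Multiset.count_nsmul] at h'
  have h1 := Multiset.nodup_iff_count_le_one.1 (nodup_roots hsep) x
  exact h'.trans ((Nat.mul_le_mul_left _ h1).trans (mul_one _).le)

/-- The order of the family of all nonzero eigenvalues. -/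
noncomputable def eigenOrder {K : Type*} [Field K] (α : K) (m : ℕ) : ℕ :=
  orderOf fun k : Finset.Icc 1 m => α ^ (k : ℕ) + (α ^ (k : ℕ))⁻¹

theorem eigenOrder_dvd_iff {K : Type*} [Field K] (α : K) (m i : ℕ) :
    eigenOrder α m ∣ i ↔ ∀ k ∈ Finset.Icc 1 m, (α ^ k + (α ^ k)⁻¹) ^ i = 1 := by
  rw [eigenOrder, orderOf_dvd_iff_pow_eq_one, funext_iff]
  simp

theorem eigenOrder_dvd_two_pow_sord_sub_one {α : K} {m : ℕ} (hα : IsPrimitiveRoot α (2 * m + 1)) :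
    eigenOrder α m ∣ 2 ^ sord (2 * m + 1) - 1 := by
  rw [eigenOrder_dvd_iff]
  intro k hk
  have h0 := pow_add_inv_ne_zero hα hk
  apply mul_right_cancel₀ h0
  rw [← pow_succ, Nat.sub_add_cancel Nat.one_le_two_pow, one_mul]
  exact pow_add_inv_pow_two_pow_sord (odd_two_mul_add_one m) hα k

theorem exists_dvd_X_pow_mul_iff {α : K} {m : ℕ} (hm : 0 < m) (hα : IsPrimitiveRoot α (2 * m + 1))
    (a : ℕ) {i : ℕ} (hi : i ≠ 0) :
    (∃ k, X ^ (2 ^ a - 1) * eigenPoly α m ^ 2 ^ (a + 1) ∣ X ^ k * (X ^ i - 1)) ↔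
      2 ^ (a + 1) * eigenOrder α m ∣ i := by
  constructor
  · rintro ⟨k, hk⟩
    have hdvd : ∀ l ∈ Finset.Icc 1 m,
        (X - C (α ^ l + (α ^ l)⁻¹)) ^ 2 ^ (a + 1) ∣ X ^ k * (X ^ i - 1) := fun l hl =>
      (pow_dvd_pow_of_dvd (X_sub_C_dvd_eigenPoly α hl) _).trans ((dvd_mul_left _ _).trans hk)
    have hodd : Odd (2 ^ sord (2 * m + 1) - 1) :=
      Nat.Even.sub_odd Nat.one_le_two_pow
        (Nat.even_pow.2 ⟨even_two, (sord_mem (odd_two_mul_add_one m)).1.ne'⟩) odd_one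
    refine Nat.Coprime.mul_dvd_of_dvd_of_dvd ?_ ?_ ?_
    · exact Nat.Coprime.pow_left _ (Nat.coprime_two_left.2
        (hodd.of_dvd_nat (eigenOrder_dvd_two_pow_sord_sub_one hα)))
    · obtain ⟨s, t, ht, rfl⟩ := Nat.exists_eq_two_pow_mul_odd hi
      have h1 : 1 ∈ Finset.Icc 1 m := Finset.mem_Icc.2 ⟨le_rfl, hm⟩
      exact (pow_dvd_pow 2 ((Nat.pow_le_pow_iff_right one_lt_two).1
        (le_two_pow_of_pow_dvd (pow_add_inv_ne_zero hα h1) ht (hdvd 1 h1)))).mul_right t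
    · rw [eigenOrder_dvd_iff]
      intro l hl
      have h := dvd_iff_isRoot.1 ((dvd_pow_self _ (by positivity)).trans (hdvd l hl))
      simpa [pow_add_inv_ne_zero hα hl, sub_eq_zero] using h
  · rintro ⟨t, rfl⟩
    -- This exponent absorbs the nilpotent factor of `S_n`.
    refine ⟨2 ^ a - 1, mul_dvd_mul_left _ ?_⟩
    have h := sub_pow_char_pow (p := 2) (n := a + 1) (X ^ (eigenOrder α m * t)) (1 : K[X])
    rw [mul_assoc, mul_comm, pow_mul, ← one_pow (M := K[X]) (2 ^ (a + 1)), ← h]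
    refine pow_dvd_pow_of_dvd (eigenPoly_dvd hα fun l hl => ?_) _
    simpa [sub_eq_zero] using (eigenOrder_dvd_iff α m _).1 (dvd_mul_right _ t) l hl

end CharTwo

theorem cycleLength_eq_of_forall_iff {M : Type*} [Monoid M] [Finite M] {x : M} {c : ℕ}
    (hc : 0 < c) (h : ∀ i ≠ 0, (∃ k, x ^ k = x ^ (k + i)) ↔ c ∣ i) : cycleLength x = c := by
  obtain ⟨hpos, hk⟩ := cycleLength_mem x
  exact le_antisymm (Nat.sInf_le ⟨hc, (h c hc.ne').2 dvd_rfl⟩)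
    (Nat.le_of_dvd hpos ((h _ hpos.ne').1 hk))

end LightsOut

open LightsOut in
theorem mainTheorem4 (n a b : ℕ) (hn : n + 1 = 2 ^ a * b) (hb : Odd b) :
    (1 < b → ∃ q : ℕ, q ∣ 2 ^ LightsOut.sord b - 1 ∧
      LightsOut.cycleLength (LightsOut.phiMatrix n) =
        2 ^ (a + 1) * ((2 ^ LightsOut.sord b - 1) / q)) ∧
    (b = 1 → LightsOut.cycleLength (LightsOut.phiMatrix n) = 1) ∧
    (∀ (K : Type*) [Field K] [Algebra (ZMod 2) K] (α : K), IsPrimitiveRoot α b →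
      {μ : K | μ ≠ 0 ∧ Module.End.HasEigenvalue
          (Matrix.toLin' ((LightsOut.phiMatrix n).map (algebraMap (ZMod 2) K))) μ} =
        {μ : K | ∃ k : ℕ, 1 ≤ k ∧ k ≤ (b - 1) / 2 ∧ μ = α ^ k + (α ^ k)⁻¹} ∧
      Nat.card (Subfield.closure {μ : K | Module.End.HasEigenvalue
          (Matrix.toLin' ((LightsOut.phiMatrix n).map (algebraMap (ZMod 2) K))) μ}) =
        2 ^ LightsOut.sord b) := by
  obtain ⟨m, rfl⟩ := hb
  refine ⟨fun hb1 => ?_, fun hb1 => ?_, ?_⟩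
  · have hm : 0 < m := by omega
    have : CharP (AlgebraicClosure (ZMod 2)) 2 := charP_of_injective_algebraMap' (ZMod 2) 2
    have : NeZero ((2 * m + 1 : ℕ) : ZMod 2) := ⟨by
      rw [Ne, CharP.cast_eq_zero_iff (ZMod 2) 2]; omega⟩
    obtain ⟨α, hα⟩ := HasEnoughRootsOfUnity.exists_primitiveRoot
      (AlgebraicClosure (ZMod 2)) (2 * m + 1)
    have hdvd := eigenOrder_dvd_two_pow_sord_sub_one hα
    have hpos : 0 < 2 ^ sord (2 * m + 1) - 1 :=
      Nat.sub_pos_of_lt (Nat.one_lt_two_pow (sord_mem (odd_two_mul_add_one m)).1.ne')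
    -- Here `q` is the cofactor of `eigenOrder α m`.
    refine ⟨_, Nat.div_dvd_of_dvd hdvd, ?_⟩
    rw [Nat.div_div_self hdvd hpos.ne']
    refine cycleLength_eq_of_forall_iff
      (Nat.mul_pos (by positivity) (Nat.pos_of_dvd_of_pos hdvd hpos)) fun i hi => ?_
    simp_rw [phiMatrix_pow_eq_iff (AlgebraicClosure (ZMod 2)),
      S_eq_X_pow_mul_eigenPoly_pow hα hn]
    exact exists_dvd_X_pow_mul_iff hm hα a hi
  · obtain rfl : m = 0 := by omega
    refine cycleLength_eq_of_forall_iff one_pos fun i _ => iff_of_true ⟨2 ^ a - 1, ?_⟩ (one_dvd i)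
    -- With `b = 1` the product `P` is empty: `A_n` is nilpotent.
    rw [phiMatrix_pow_eq_iff (ZMod 2),
      S_eq_X_pow_mul_eigenPoly_pow (α := (1 : ZMod 2)) (m := 0) (by simp) hn]
    simp [eigenPoly]
  · intro K _ _ α hα
    have : CharP K 2 := charP_of_injective_algebraMap' (ZMod 2) 2
    have hset : ∀ μ : K, μ ≠ 0 → (Module.End.HasEigenvalue
        (Matrix.toLin' ((phiMatrix n).map (algebraMap (ZMod 2) K))) μ ↔
        ∃ k ∈ Finset.Icc 1 m, μ = α ^ k + (α ^ k)⁻¹) := fun μ hμ =>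
      (hasEigenvalue_phiMatrixMap_iff K n μ).trans (isRoot_S_iff hα hn hμ)
    refine ⟨?_, ?_⟩
    · ext μ
      simp only [Set.mem_ofPred_eq, show (2 * m + 1 - 1) / 2 = m by omega, ← and_assoc,
        ← Finset.mem_Icc]
      refine ⟨fun ⟨h0, h⟩ => (hset μ h0).1 h, fun h => ?_⟩
      have h0 : μ ≠ 0 := by
        obtain ⟨k, hk, rfl⟩ := h
        exact pow_add_inv_ne_zero hα hk
      exact ⟨h0, (hset μ h0).2 h⟩
    · refine card_subfield_closure_eq_two_pow_sord (odd_two_mul_add_one m) hα (fun μ hμ => ?_) ?_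
      · rcases eq_or_ne μ 0 with rfl | h0
        · exact zero_pow (by positivity)
        · obtain ⟨k, -, rfl⟩ := (hset μ h0).1 hμ
          exact pow_add_inv_pow_two_pow_sord (odd_two_mul_add_one m) hα k
      · rcases Nat.eq_zero_or_pos m with rfl | hm
        · have h1 : α = 1 := by simpa using hα
          rw [h1, inv_one, CharTwo.add_self_eq_zero]
          exact zero_mem _
        · have h1 : 1 ∈ Finset.Icc 1 m := Finset.mem_Icc.2 ⟨le_rfl, hm⟩
          have h0 := pow_add_inv_ne_zero hα h1
          refine Subfield.subset_closure ?_
          rw [pow_one] at h0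
          exact (hset _ h0).2 ⟨1, h1, by rw [pow_one]⟩
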